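/- Let $k\ge 2$ be an integer and $[k]=\{1,\dots,k\}$. A word over $k$ is a finite (possibly empty) sequence of elements of $[k]$; the set of all words over $k$ is denoted by $[k]^{<\mathbb N}$, and concatenation by $^\smallfrown$. A left variable word over $k$ is a nonempty finite sequence with entries in $[k]\cup\{v\}$, where $v\notin[k]$ is a fixed symbol, whose first entry is $v$; for such $w$ and $a\in[k]$, $w(a)$ is the word obtained by replacing every occurrence of $v$ in $w$ by $a$. For $n\ge 1$, an $n$-dimensional Carlson–Simpson tree of $[k]^{<\mathbb N}$ is a set of the form $$W=\{c\}\cup\{c^\smallfrown w_0(a_0)^\smallfrown\cdots{}^\smallfrown w_i(a_i): 0\le i\le n-1,\ a_0,\dots,a_i\in[k]\},$$ where $c$ is a word over $k$ and $w_0,\dots,w_{n-1}$ are left variable words over $k$. For $\ell\ge 1$ let $\mathrm{Subtr}_\ell(W)$ be the set of all $\ell$-dimensional Carlson–Simpson trees of $[k]^{<\mathbb N}$ that are contained in $W$. **Theorem 4.1.** For every integer $k\ge 2$, every pair of integers $d\ge m\ge 1$ and every integer $r\ge 1$ there exists $N\in\mathbb N=\{0,1,2,\dots\}$ with the following property. If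 $n\ge N$ and $W$ is an $n$-dimensional Carlson–Simpson tree of $[k]^{<\mathbb N}$, then for every $r$-coloring of the set $\mathrm{Subtr}_m(W)$ there exists $U\in\mathrm{Subtr}_d(W)$ such that the set $\mathrm{Subtr}_m(U)$ is monochromatic. Consequently there is a least $N\in\mathbb N$ with this property; it is denoted by $\mathrm{CS}(k,d,m,r)$. -/

import Mathlib

namespace CarlsonSimpson

/-- Words over `k`: finite sequences of letters. The alphabet `[k] = {1, ..., k}` is modelled by
`Fin k`. -/
abbrev Word (k : ℕ) : Type := List (Fin k)

/-- Finite sequences over `[k] ∪ {v}`; the variable `v` is `none`, a letter `a` is `some a`. -/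
abbrev VarSeq (k : ℕ) : Type := List (Option (Fin k))

/-- A left variable word over `k`: its leftmost letter exists and is the variable `v`
(so that `v` does appear). -/
def IsLeftVariableWord {k : ℕ} (w : VarSeq k) : Prop :=
  w.head? = some none

/-- `w(a)`: substitute the letter `a` for all appearances of the variable in `w`. -/
def subst {k : ℕ} (w : VarSeq k) (a : Fin k) : Word k :=
  w.map fun x => x.getD a

/-- The word `c ⌢ w₀(a₀) ⌢ ... ⌢ wₙ₋₁(aₙ₋₁)` for `a = (a₀, ..., aₙ₋₁)` with `n ≤ ws.length`;
it is `c` for the empty `a`. -/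
def point {k : ℕ} (c : Word k) (ws : List (VarSeq k)) (a : Word k) : Word k :=
  c ++ (List.zipWith subst ws a).flatten

/-- The set generated by `(c, w₀, ..., wₘ₋₁)`, that is
`{c} ∪ {c ⌢ w₀(a₀) ⌢ ... ⌢ wₙ(aₙ) : n ∈ {0, ..., m - 1}, a₀, ..., aₙ ∈ [k]}`. -/
def generated {k : ℕ} (c : Word k) (ws : List (VarSeq k)) : Set (Word k) :=
  {x | ∃ a : Word k, a.length ≤ ws.length ∧ x = point c ws a}

/-- `W` is an `m`-dimensional Carlson–Simpson tree of `[k]^{<ℕ}`: it is generated by a word `c` and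
a nonempty sequence of `m` left variable words. -/
def IsTree {k : ℕ} (m : ℕ) (W : Set (Word k)) : Prop :=
  ∃ (c : Word k) (ws : List (VarSeq k)), ws ≠ [] ∧ ws.length = m ∧
    (∀ w ∈ ws, IsLeftVariableWord w) ∧ W = generated c ws

/-- `Subtr_m(W)`: the `m`-dimensional Carlson–Simpson trees contained in `W`. -/
def Subtr {k : ℕ} (m : ℕ) (W : Set (Word k)) : Set (Set (Word k)) :=
  {V | IsTree m V ∧ V ⊆ W}

/-- The property that defines the numbers `CS(k, d, m, r)`: whenever `n ≥ N` and `W` is an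
`n`-dimensional Carlson–Simpson tree, every `r`-coloring of `Subtr_m(W)` admits some
`U ∈ Subtr_d(W)` with `Subtr_m(U)` monochromatic. (As `U ⊆ W`, every member of `Subtr_m(U)` is a
member of `Subtr_m(W)`.) -/
def PartitionProperty (k d m r N : ℕ) : Prop :=
  ∀ n : ℕ, N ≤ n → ∀ W : Set (Word k), IsTree n W →
    ∀ color : Subtr m W → Fin r,
      ∃ U ∈ Subtr d W, ∃ i : Fin r,
        ∀ V : Subtr m W, (V : Set (Word k)) ∈ Subtr m U → color V = i

end CarlsonSimpson

/-!
A tree of dimension `m` is encoded by its generic word `c ⌢ w₀(e₀) ⌢ ⋯ ⌢ wₘ₋₁(eₘ₋₁)` over the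
alphabet `K = [k]` enlarged by `m` labels. A coloring of the subtrees of `W` becomes a coloring `f`
of words (`generic_inj`, which makes it well defined, and `exists_image_eq`, by which all subtrees
arise in this way; the latter needs two letters). What is wanted is a tree `U` over `K` such that
`f` is constant on the values at `U` of all generic words. The proof combines two Ramsey theorems.

* By the Hales–Jewett theorem, used repeatedly, there are trees of arbitrarily large dimension along
  which `f` does not distinguish between the letters of `K` (`exists_tree_forall_eq`). This leaves
  the case of a one-letter alphabet.
* Over one letter, a generic word is a sequence of finite sets `s₀ < ⋯ < sₘ₋₁` of places (those of
  the labels) together with the length of the word, and the latter can be viewed as the minimum of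
  one more finite set `sₘ`. So this case is a form of the Milliken–Taylor theorem for sequences of
  `m + 1` sets. It follows from an ultrafilter on the finite sets that is idempotent for unions,
  by taking the iterated limit of the colors and choosing one block after the other such that all
  the words formed so far keep the limit color (`exists_tree_of_forall_isGood`). A variable word
  extends from the minimum of its block to the minimum of the next one, and so it starts with its
  variable.

Since the dimension needed in the one-letter case must be known before the Hales–Jewett step, and
since the theorem asks for a bound, both are made finitary by compactness
(`exists_bound_isMonoTree`).
-/

/-! ### Substitution and composition -/

namespace CarlsonSimpson

section Substitution

variable {K L L' : Type}

/-- The variable word `w` over the alphabet `K` (with `none` as the variable) starts with its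
variable. -/
def IsLeft (w : List (Option K)) : Prop := w.head? = some none

/-- `w(b)` for a letter `b` of an alphabet `L` that contains `K` by means of `ι`. -/
def substVia (ι : K → L) (w : List (Option K)) (b : L) : List L :=
  w.map fun o => o.elim b ι

/-- `w₀(y₀) ⌢ w₁(y₁) ⌢ ⋯`, as far as both lists go, for a word `y` over an alphabet that contains
`K` by means of `ι`. -/
def eval (ι : K → L) (ws : List (List (Option K))) (y : List L) : List L :=
  (List.zipWith (substVia ι) ws y).flatten

/-- The variable words of the composite of two trees. The letters of the variable words in `ws`
index the successive members of `ts`, so that a variable word over `K` in `ws` is evaluated at `ts`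
over the alphabet `K ∪ {v}`. -/
def compose (ts : List (List (Option K))) : List (List (Option K)) → List (List (Option K))
  | [] => []
  | w :: ws => eval some ts w :: compose (ts.drop w.length) ws

/-- The sum of the lengths of the words in `ws`. -/
def total (ws : List (List (Option K))) : ℕ := (ws.map List.length).sum

@[simp] theorem total_nil : total ([] : List (List (Option K))) = 0 := rfl

@[simp] theorem total_cons (w : List (Option K)) (ws : List (List (Option K))) :
    total (w :: ws) = w.length + total ws := by simp [total]

@[simp] theorem length_substVia (ι : K → L) (w : List (Option K)) (b : L) :
    (substVia ι w b).length = w.length := by simp [substVia]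

theorem substVia_cons (ι : K → L) (o : Option K) (w : List (Option K)) (b : L) :
    substVia ι (o :: w) b = o.elim b ι :: substVia ι w b := rfl

theorem substVia_append (ι : K → L) (w w' : List (Option K)) (b : L) :
    substVia ι (w ++ w') b = substVia ι w b ++ substVia ι w' b := by simp [substVia]

theorem map_substVia (g : L → L') (ι : K → L) (w : List (Option K)) (b : L) :
    (substVia ι w b).map g = substVia (g ∘ ι) w (g b) := by
  simp only [substVia, List.map_map]
  refine List.map_congr_left fun o _ => ?_
  cases o <;> rfl

theorem substVia_map {K' : Type} (g : K → K') (ι : K' → L) (w : List (Option K)) (b : L) :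
    substVia ι (w.map (Option.map g)) b = substVia (ι ∘ g) w b := by
  simp only [substVia, List.map_map]
  refine List.map_congr_left fun o _ => ?_
  cases o <;> rfl

@[simp] theorem eval_nil_left (ι : K → L) (y : List L) : eval ι [] y = [] := rfl

@[simp] theorem eval_nil_right (ι : K → L) (ws : List (List (Option K))) : eval ι ws [] = [] := by
  simp [eval]

@[simp] theorem eval_cons (ι : K → L) (w : List (Option K)) (ws : List (List (Option K))) (b : L)
    (y : List L) : eval ι (w :: ws) (b :: y) = substVia ι w b ++ eval ι ws y := by
  simp [eval]

theorem map_eval (g : L → L') (ι : K → L) (ws : List (List (Option K))) (y : List L) :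
    (eval ι ws y).map g = eval (g ∘ ι) ws (y.map g) := by
  induction ws generalizing y with
  | nil => simp
  | cons w ws ih => cases y <;> simp [ih, map_substVia]

theorem eval_map {K' : Type} (g : K → K') (ι : K' → L) (ws : List (List (Option K)))
    (y : List L) : eval ι (ws.map (List.map (Option.map g))) y = eval (ι ∘ g) ws y := by
  induction ws generalizing y with
  | nil => simp
  | cons w ws ih => cases y <;> simp [ih, substVia_map]

theorem eval_append (ι : K → L) (ws : List (List (Option K))) (y z : List L) :
    eval ι ws (y ++ z) = eval ι ws y ++ eval ι (ws.drop y.length) z := by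
  induction ws generalizing y with
  | nil => simp
  | cons w ws ih => cases y <;> simp [ih]

theorem length_eval_le (ι : K → L) (ws : List (List (Option K))) (y : List L) :
    (eval ι ws y).length ≤ total ws := by
  induction ws generalizing y with
  | nil => simp
  | cons w ws ih => cases y <;> simp [ih]

theorem length_eval (ι : K → L) (ws : List (List (Option K))) (y : List L)
    (h : y.length = ws.length) : (eval ι ws y).length = total ws := by
  induction ws generalizing y with
  | nil => simp
  | cons w ws ih =>
    cases y with
    | nil => simp at h
    | cons b y => simp [ih y (by simpa using h)]

@[simp] theorem length_compose (ts ws : List (List (Option K))) :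
    (compose ts ws).length = ws.length := by
  induction ws generalizing ts with
  | nil => rfl
  | cons w ws ih => simp [compose, ih]

theorem substVia_eval (ι : K → L) (ts : List (List (Option K))) (w : List (Option K)) (b : L) :
    substVia ι (eval some ts w) b = eval ι ts (substVia ι w b) := by
  simp only [substVia, map_eval]
  rfl

/-- Evaluating a composite is evaluating twice. -/
theorem eval_compose (ι : K → L) (ts ws : List (List (Option K))) (y : List L) :
    eval ι (compose ts ws) y = eval ι ts (eval ι ws y) := by
  induction ws generalizing ts y with
  | nil => simp [compose]
  | cons w ws ih =>
    cases y with
    | nil => simp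
    | cons b y => simp [compose, eval_append, ih, substVia_eval]

theorem IsLeft.map {K' : Type} {w : List (Option K)} (hw : IsLeft w) (g : K → K') :
    IsLeft (w.map (Option.map g)) := by
  simp only [IsLeft] at hw ⊢
  simp [hw]

theorem isLeft_eval {ts : List (List (Option K))} (hts : ∀ t ∈ ts, IsLeft t)
    {w : List (Option K)} (hw : IsLeft w) (h : w.length ≤ ts.length) : IsLeft (eval some ts w) := by
  obtain _ | ⟨o, w⟩ := w
  · simp [IsLeft] at hw
  obtain _ | ⟨t, ts⟩ := ts
  · simp at h
  have ht := hts t (by simp)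
  obtain _ | ⟨p, t⟩ := t
  · simp [IsLeft] at ht
  simp only [IsLeft, List.head?_cons, Option.some.injEq] at hw ht
  simp [IsLeft, substVia_cons, hw, ht]

theorem isLeft_compose {ts ws : List (List (Option K))} (hts : ∀ t ∈ ts, IsLeft t)
    (hws : ∀ w ∈ ws, IsLeft w) (h : total ws ≤ ts.length) : ∀ u ∈ compose ts ws, IsLeft u := by
  induction ws generalizing ts with
  | nil => simp [compose]
  | cons w ws ih =>
    simp only [total_cons] at h
    simp only [compose, List.mem_cons, forall_eq_or_imp]
    refine ⟨isLeft_eval hts (hws w (by simp)) (by omega), ih (fun t ht => hts t ?_)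
      (fun w hw => hws w (by simp [hw])) (by simp; omega)⟩
    exact List.mem_of_mem_drop ht

/-- A word is recovered from its value at a tree, because a left variable word remembers the letter
substituted into it. -/
theorem eq_append_of_eval_eq_append (ι : K → L) {ts : List (List (Option K))}
    (hts : ∀ t ∈ ts, IsLeft t) {a z u : List L} (ha : a.length ≤ ts.length)
    (hz : z.length ≤ ts.length) (h : eval ι ts z = eval ι ts a ++ u) :
    ∃ z', z = a ++ z' ∧ u = eval ι (ts.drop a.length) z' := by
  induction ts generalizing a z with
  | nil =>
    simp only [List.length_nil, Nat.le_zero, List.length_eq_zero_iff] at ha hz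
    subst ha hz
    exact ⟨[], by simpa using h.symm⟩
  | cons t ts ih =>
    obtain _ | ⟨b, a⟩ := a
    · exact ⟨z, by simp, by simpa using h.symm⟩
    have ht := hts t (by simp)
    obtain _ | ⟨o, t⟩ := t
    · simp [IsLeft] at ht
    simp only [IsLeft, List.head?_cons, Option.some.injEq] at ht
    subst ht
    obtain _ | ⟨b', z⟩ := z
    · simp [substVia_cons] at h
    simp only [eval_cons, substVia_cons, Option.elim_none, List.cons_append, List.cons.injEq,
      List.append_assoc] at h
    obtain ⟨rfl, h⟩ := h
    obtain ⟨z', rfl, hu⟩ := ih (fun t ht => hts t (by simp [ht])) (by simpa using ha)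
      (by simpa using hz) (List.append_cancel_left h)
    exact ⟨z', rfl, by simpa using hu⟩

/-- Over an alphabet with at least two letters, a variable word is determined by its
substitutions. -/
theorem eq_of_forall_substVia [Nontrivial K] {u w : List (Option K)}
    (h : ∀ b, substVia id u b = substVia id w b) : u = w := by
  induction u generalizing w with
  | nil =>
    obtain ⟨b⟩ : Nonempty K := inferInstance
    have := congrArg List.length (h b)
    simp only [length_substVia, List.length_nil] at this
    exact (List.length_eq_zero_iff.1 this.symm).symm
  | cons o u ih =>
    obtain _ | ⟨p, w⟩ := w
    · obtain ⟨b⟩ : Nonempty K := inferInstance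
      simpa using congrArg List.length (h b)
    simp only [substVia_cons, List.cons.injEq] at h
    have hop : o = p := by
      cases o with
      | none =>
        cases p with
        | none => rfl
        | some a =>
          obtain ⟨b, hb⟩ := exists_ne a
          exact absurd (h b).1 hb
      | some a =>
        cases p with
        | none =>
          obtain ⟨b, hb⟩ := exists_ne a
          exact absurd (h b).1.symm hb
        | some c => exact congrArg some (h a).1
    rw [hop, ih fun b => (h b).2]

/-- A variable word all of whose substitutions are values at `ts` is itself a value at `ts`. -/
theorem exists_eq_eval_some [Nontrivial K] {ts : List (List (Option K))}
    (hts : ∀ t ∈ ts, IsLeft t) {u : List (Option K)}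
    (h : ∀ b, ∃ z : List K, z.length ≤ ts.length ∧ substVia id u b = eval id ts z) :
    ∃ w : List (Option K), w.length ≤ ts.length ∧ u = eval some ts w := by
  induction ts generalizing u with
  | nil =>
    obtain ⟨b⟩ : Nonempty K := inferInstance
    obtain ⟨z, -, hz⟩ := h b
    refine ⟨[], le_rfl, ?_⟩
    have := congrArg List.length hz
    simpa using this
  | cons t ts ih =>
    obtain _ | ⟨o, u⟩ := u
    · exact ⟨[], by simp, by simp⟩
    have ht := hts t (by simp)
    have key : ∀ b, ∃ z : List K, z.length ≤ ts.length ∧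
        substVia id (o :: u) b = substVia id t (o.elim b id) ++ eval id ts z := by
      intro b
      obtain ⟨z, hz, hb⟩ := h b
      obtain _ | ⟨a, z⟩ := z
      · simp [substVia_cons] at hb
      refine ⟨z, by simpa using hz, ?_⟩
      rw [hb, eval_cons]
      obtain _ | ⟨p, t⟩ := t
      · simp [IsLeft] at ht
      simp only [IsLeft, List.head?_cons, Option.some.injEq] at ht
      subst ht
      simp only [eval_cons, substVia_cons, Option.elim_none, List.cons_append,
        List.cons.injEq] at hb
      rw [hb.1]
    -- Lengths agree, so the value of `t` can be split off from the front of `u`.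
    have hlen : ∀ b, (substVia id ((o :: u).take t.length) b) = substVia id t (o.elim b id) ∧
        ∃ z : List K, z.length ≤ ts.length ∧
          substVia id ((o :: u).drop t.length) b = eval id ts z := by
      intro b
      obtain ⟨z, hz, hb⟩ := key b
      rw [← List.take_append_drop t.length (o :: u), substVia_append] at hb
      have hl : t.length ≤ (o :: u).length := by
        have := congrArg List.length hb
        rw [← substVia_append, List.take_append_drop] at this
        simp only [length_substVia, List.length_append] at this
        omega
      obtain ⟨h1, h2⟩ := List.append_inj hb
        (by simp only [length_substVia, List.length_take]; omega)
      exact ⟨h1, z, hz, h2⟩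
    obtain ⟨w, hw, hu⟩ := ih (fun t ht => hts t (by simp [ht])) fun b => (hlen b).2
    refine ⟨o :: w, by simpa using hw, ?_⟩
    rw [eval_cons, ← hu]
    have : (o :: u).take t.length = substVia some t o := by
      refine eq_of_forall_substVia fun b => (hlen b).1.trans ?_
      simp only [substVia, List.map_map]
      refine List.map_congr_left fun p _ => ?_
      cases p <;> rfl
    rw [← this, List.take_append_drop]

/-- A tree with root `x` all of whose points are values at `ts` is a composite with `ts`. -/
theorem exists_eq_compose [Nontrivial K] {ts : List (List (Option K))}
    (hts : ∀ t ∈ ts, IsLeft t) {us : List (List (Option K))} (hus : ∀ u ∈ us, IsLeft u)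
    {a : List K} (ha : a.length ≤ ts.length)
    (h : ∀ b : List K, b.length ≤ us.length → ∃ z : List K, z.length ≤ ts.length ∧
      eval id ts a ++ eval id us b = eval id ts z) :
    ∃ ws : List (List (Option K)), (∀ w ∈ ws, IsLeft w) ∧ ws.length = us.length ∧
      a.length + total ws ≤ ts.length ∧ us = compose (ts.drop a.length) ws := by
  induction us generalizing a with
  | nil => exact ⟨[], by simp, rfl, by simpa using ha, rfl⟩
  | cons u us ih =>
    have hts' : ∀ t ∈ ts.drop a.length, IsLeft t := fun t ht => hts t (List.mem_of_mem_drop ht)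
    obtain ⟨w, hw, hu⟩ : ∃ w : List (Option K), w.length ≤ (ts.drop a.length).length ∧
        u = eval some (ts.drop a.length) w := by
      refine exists_eq_eval_some hts' fun b => ?_
      obtain ⟨z, hz, hb⟩ := h [b] (by simp)
      obtain ⟨z', rfl, hz'⟩ := eq_append_of_eval_eq_append id hts ha hz hb.symm
      refine ⟨z', by simp at hz ⊢; omega, by simpa using hz'⟩
    have hwl : IsLeft w := by
      have hul := hus u (by simp)
      obtain _ | ⟨o, w⟩ := w
      · simp [hu, IsLeft] at hul
      generalize ts.drop a.length = ts' at *
      obtain _ | ⟨t, ts'⟩ := ts'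
      · simp at hw
      have ht := hts' t (by simp)
      obtain _ | ⟨p, t⟩ := t
      · simp [IsLeft] at ht
      simp only [IsLeft, List.head?_cons, Option.some.injEq] at ht
      simpa [hu, IsLeft, ht, substVia_cons] using hul
    obtain ⟨b⟩ : Nonempty K := inferInstance
    simp only [List.length_drop] at hw
    have hsplit : eval id ts (a ++ substVia id w b) = eval id ts a ++ substVia id u b := by
      rw [eval_append, hu, substVia_eval]
    obtain ⟨ws, hws, hlen, htot, hc⟩ := ih (a := a ++ substVia id w b)
      (fun u hu => hus u (by simp [hu])) (by simp; omega) (fun y hy => by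
        obtain ⟨z, hz, hyz⟩ := h (b :: y) (by simpa using hy)
        exact ⟨z, hz, by rw [hsplit, ← hyz]; simp⟩)
    refine ⟨w :: ws, by simpa using ⟨hwl, hws⟩, by simp [hlen], ?_, ?_⟩
    · simp at htot ⊢
      omega
    · rw [compose, ← hu, hc]
      simp

end Substitution

/-! ### Generic words -/

section Generic

variable {K E : Type}

/-- The generic word of the tree generated by `(c, w₀, …)`: the word
`c ⌢ w₀(e₀) ⌢ w₁(e₁) ⌢ ⋯` over the alphabet enlarged by the labels `es = (e₀, e₁, …)`. -/
def generic (es : List E) (c : List K) (ws : List (List (Option K))) : List (K ⊕ E) :=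
  c.map Sum.inl ++ eval Sum.inl ws (es.map Sum.inr)

/-- `y` is the generic word, with the labels `es`, of some tree of dimension `es.length`. -/
def IsGeneric (es : List E) (y : List (K ⊕ E)) : Prop :=
  ∃ (c : List K) (ws : List (List (Option K))), (∀ w ∈ ws, IsLeft w) ∧
    ws.length = es.length ∧ y = generic es c ws

theorem eq_of_append_cons_eq {α : Type} {e : α} {x x' z z' : List α} (hx : e ∉ x) (hx' : e ∉ x')
    (h : x ++ e :: z = x' ++ e :: z') : x = x' ∧ z = z' := by
  induction x generalizing x' with
  | nil =>
    cases x' with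
    | nil => exact ⟨rfl, (List.cons.inj h).2⟩
    | cons a' x' => exact absurd ((List.cons.inj h).1 ▸ List.mem_cons_self) hx'
  | cons a x ih =>
    cases x' with
    | nil => exact absurd ((List.cons.inj h).1 ▸ List.mem_cons_self) hx
    | cons a' x' =>
      simp only [List.cons_append, List.cons.injEq] at h
      obtain ⟨rfl, h⟩ := h
      have := ih (fun h => hx (List.mem_cons_of_mem _ h)) (fun h => hx' (List.mem_cons_of_mem _ h)) h
      exact ⟨congrArg (a :: ·) this.1, this.2⟩

theorem eq_of_append_eval_eq {es : List E} (hes : es.Nodup) {ws ws' : List (List (Option K))}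
    (hws : ∀ w ∈ ws, IsLeft w) (hws' : ∀ w ∈ ws', IsLeft w) (hl : ws.length = es.length)
    (hl' : ws'.length = es.length) {x x' : List (K ⊕ E)} (hx : ∀ e ∈ es, Sum.inr e ∉ x)
    (hx' : ∀ e ∈ es, Sum.inr e ∉ x')
    (h : x ++ eval Sum.inl ws (es.map Sum.inr) = x' ++ eval Sum.inl ws' (es.map Sum.inr)) :
    x = x' ∧ ws = ws' := by
  induction es generalizing x x' ws ws' with
  | nil =>
    simp only [List.length_nil, List.length_eq_zero_iff] at hl hl'
    subst hl hl'
    simpa using h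
  | cons e es ih =>
    obtain _ | ⟨w, ws⟩ := ws
    · simp at hl
    obtain _ | ⟨w', ws'⟩ := ws'
    · simp at hl'
    have hw := hws w (by simp)
    have hw' := hws' w' (by simp)
    obtain _ | ⟨o, w⟩ := w
    · simp [IsLeft] at hw
    obtain _ | ⟨o', w'⟩ := w'
    · simp [IsLeft] at hw'
    simp only [IsLeft, List.head?_cons, Option.some.injEq] at hw hw'
    subst hw hw'
    simp only [List.map_cons, eval_cons, substVia_cons, Option.elim_none, List.cons_append] at h
    obtain ⟨rfl, h'⟩ := eq_of_append_cons_eq (hx e (by simp)) (hx' e (by simp)) h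
    have hn : ∀ v : List (Option K), ∀ f ∈ es,
        Sum.inr f ∉ substVia Sum.inl v (Sum.inr e : K ⊕ E) := by
      intro v f hf hmem
      obtain ⟨o, -, ho⟩ := List.mem_map.1 hmem
      cases o with
      | none =>
        simp only [Option.elim_none, Sum.inr.injEq] at ho
        exact (List.nodup_cons.1 hes).1 (ho ▸ hf)
      | some a => simp at ho
    obtain ⟨h1, rfl⟩ := ih (List.nodup_cons.1 hes).2 (fun w h => hws w (List.mem_cons_of_mem _ h))
      (fun w h => hws' w (List.mem_cons_of_mem _ h)) (by simpa using hl) (by simpa using hl') (hn w) (hn w') h'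
    have hinj : Function.Injective fun o : Option K => o.elim (Sum.inr e : K ⊕ E) Sum.inl := by
      intro o o'
      cases o <;> cases o' <;> simp
    rw [List.map_injective_iff.2 hinj h1]
    exact ⟨rfl, rfl⟩

/-- A tree is determined by its generic word. -/
theorem generic_inj {es : List E} (hes : es.Nodup) {c c' : List K}
    {ws ws' : List (List (Option K))} (hws : ∀ w ∈ ws, IsLeft w) (hws' : ∀ w ∈ ws', IsLeft w)
    (hl : ws.length = es.length) (hl' : ws'.length = es.length)
    (h : generic es c ws = generic es c' ws') : c = c' ∧ ws = ws' := by
  obtain ⟨h1, h2⟩ := eq_of_append_eval_eq hes hws hws' hl hl' (by simp) (by simp) h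
  exact ⟨List.map_injective_iff.2 Sum.inl_injective h1, h2⟩

/-- The generic word of a composite tree is obtained by evaluation. -/
theorem generic_compose (es : List E) (c₀ c : List K) (ts ws : List (List (Option K))) :
    generic es (c₀ ++ eval id ts c) (compose (ts.drop c.length) ws) =
      c₀.map Sum.inl ++ eval Sum.inl ts (generic es c ws) := by
  simp [generic, eval_append, eval_compose, map_eval]

theorem length_generic {es : List E} {c : List K} {ws : List (List (Option K))}
    (hl : ws.length = es.length) : (generic es c ws).length = c.length + total ws := by
  simp [generic, length_eval, hl]

theorem map_generic {K' : Type} (g : K → K') (es : List E) (c : List K)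
    (ws : List (List (Option K))) :
    (generic es c ws).map (Sum.map g id) =
      generic es (c.map g) (ws.map (List.map (Option.map g))) := by
  simp only [generic, List.map_append, List.map_map, map_eval, eval_map]
  rfl

end Generic

end CarlsonSimpson

/-! ### Making a coloring blind to the letters -/

namespace CarlsonSimpson

section HalesJewett

variable {K E : Type}

theorem exists_eq_map_some_append_isLeft {u : List (Option K)} (h : none ∈ u) :
    ∃ (p : List K) (q : List (Option K)), IsLeft q ∧ u = p.map some ++ q := by
  induction u with
  | nil => simp at h
  | cons o u ih =>
    cases o with
    | none => exact ⟨[], none :: u, rfl, rfl⟩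
    | some a =>
      obtain ⟨p, q, hq, rfl⟩ := ih (by simpa using h)
      exact ⟨a :: p, q, hq, rfl⟩

/-- The Hales–Jewett theorem for words: the constant letters before the first occurrence of the
variable are split off, which leaves a left variable word. -/
theorem exists_mono_left (K κ : Type) [Finite K] [Finite κ] :
    ∃ n : ℕ, ∀ C : List K → κ, ∃ (p : List K) (q : List (Option K)), IsLeft q ∧
      p.length + q.length = n ∧ ∃ i, ∀ a, C (p ++ substVia id q a) = i := by
  obtain ⟨ι, _, hι⟩ := Combinatorics.Line.exists_mono_in_high_dimension K κ
  refine ⟨Fintype.card ι, fun C => ?_⟩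
  let e := Fintype.equivFin ι
  obtain ⟨l, i, hi⟩ := hι fun v => C (List.ofFn (v ∘ e.symm))
  obtain ⟨j, hj⟩ := l.proper
  obtain ⟨p, q, hq, hpq⟩ := exists_eq_map_some_append_isLeft
    (u := List.ofFn (l.idxFun ∘ e.symm)) ((List.mem_ofFn' _ _).2 ⟨e j, by simpa using hj⟩)
  refine ⟨p, q, hq, by simpa using (congrArg List.length hpq).symm, i, fun a => ?_⟩
  rw [← hi a]
  have := congrArg (fun u => substVia id u a) hpq
  simp only [substVia_append] at this
  have hp : substVia id (p.map some) a = p := by simp [substVia, Function.comp_def]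
  rw [hp] at this
  rw [← this]
  congr 1
  simp only [substVia, List.map_ofFn]
  congr 1
  funext j
  simp only [Function.comp, Combinatorics.Line.coe_apply]
  cases l.idxFun (e.symm j) <;> rfl

/-- On the values of a suitable tree of any prescribed dimension, a coloring of the words over an
alphabet `K ∪ E` does not distinguish between the letters of `K`. The first variable word has a
length that only depends on the dimension, so the later ones may be chosen before it, uniformly in
all words that can precede them. -/
theorem exists_tree_forall_eq [Finite K] [Finite E] (D : ℕ) :
    ∀ (κ : Type) [Finite κ] (F : List (K ⊕ E) → κ),
      ∃ (c : List K) (ws : List (List (Option K))), (∀ w ∈ ws, IsLeft w) ∧ ws.length = D ∧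
        ∀ y y' : List (K ⊕ E), y.length ≤ D →
          y.map (Sum.map (fun _ => ()) id) = y'.map (Sum.map (fun _ => ()) id) →
          F (c.map Sum.inl ++ eval Sum.inl ws y) = F (c.map Sum.inl ++ eval Sum.inl ws y') := by
  induction D with
  | zero =>
    refine fun κ _ F => ⟨[], [], by simp, rfl, fun y y' _ _ => by simp⟩
  | succ D ih =>
    intro κ _ F
    have : Finite {y : List (K ⊕ E) // y.length ≤ D} :=
      (List.finite_length_le (K ⊕ E) D).to_subtype
    obtain ⟨n, hn⟩ := exists_mono_left K ({y : List (K ⊕ E) // y.length ≤ D} → κ)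
    have : Finite {x : List (K ⊕ E) // x.length ≤ n} :=
      (List.finite_length_le (K ⊕ E) n).to_subtype
    obtain ⟨c, ws, hws, hlen, hF⟩ := ih ({x : List (K ⊕ E) // x.length ≤ n} → κ)
      fun z x => F (x ++ z)
    obtain ⟨p, q, hq, hpq, i, hi⟩ := hn fun z y =>
      F (z.map Sum.inl ++ (c.map Sum.inl ++ eval Sum.inl ws y))
    -- The root `c` of the later part becomes the constant end of the first variable word.
    refine ⟨p, (q ++ c.map some) :: ws, ?_, by simp [hlen], ?_⟩
    · simp only [List.mem_cons, forall_eq_or_imp]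
      refine ⟨?_, hws⟩
      obtain _ | ⟨o, q⟩ := q
      · simp [IsLeft] at hq
      · exact hq
    intro y y' hy hyy
    obtain _ | ⟨b, y⟩ := y
    · obtain _ | ⟨b', y'⟩ := y'
      · rfl
      · simp at hyy
    obtain _ | ⟨b', y'⟩ := y'
    · simp at hyy
    simp only [List.map_cons, List.cons.injEq] at hyy
    have hy' : y'.length ≤ D := by
      have := congrArg List.length hyy.2
      simp only [List.length_map, List.length_cons] at this hy
      omega
    have hc : ∀ b : K ⊕ E, substVia Sum.inl (c.map some) b = c.map Sum.inl := fun b => by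
      simp [substVia]
    have hpqlen : ∀ b : K ⊕ E, (p.map Sum.inl ++ substVia Sum.inl q b).length ≤ n := by
      intro b
      simp [hpq]
    have h1 := congrFun (hF y y' (by simpa using hy) hyy.2) ⟨_, hpqlen b⟩
    have h2 : F (p.map Sum.inl ++ substVia Sum.inl q b ++ (c.map Sum.inl ++ eval Sum.inl ws y')) =
        F (p.map Sum.inl ++ substVia Sum.inl q b' ++ (c.map Sum.inl ++ eval Sum.inl ws y')) := by
      obtain b | b := b
      · obtain b' | b' := b'
        · have := congrFun ((hi b).trans (hi b').symm) ⟨y', hy'⟩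
          simpa only [List.map_append, map_substVia, Function.comp_id] using this
        · simp at hyy
      · obtain b' | b' := b'
        · simp at hyy
        · rw [show b = b' by simpa using hyy.1]
    simp only [eval_cons, substVia_append, hc]
    simp only [List.append_assoc] at h1 h2 ⊢
    exact h1.trans h2

end HalesJewett

end CarlsonSimpson

/-! ### The one-letter alphabet: an idempotent ultrafilter on the finite sets -/

namespace CarlsonSimpson

open Filter

section Unary

variable {E κ : Type}

/-- There is an ultrafilter on the finite subsets of `ℕ`, idempotent with respect to union, whose
members go to infinity. -/
theorem exists_idempotent_union :
    ∃ p : Ultrafilter (Finset ℕ), (∀ n : ℕ, ∀ᶠ s : Finset ℕ in p, s.Nonempty ∧ ∀ t ∈ s, n ≤ t) ∧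
      ∀ P : Finset ℕ → Prop, (∀ᶠ s in p, P s) → ∀ᶠ s in p, ∀ᶠ t in p, P (s ∪ t) := by
  let _ : Semigroup (Finset ℕ) := { mul := (· ∪ ·), mul_assoc := Finset.union_assoc }
  let _ : Semigroup (Ultrafilter (Finset ℕ)) := Ultrafilter.semigroup
  let S : Set (Ultrafilter (Finset ℕ)) :=
    ⋂ n : ℕ, {U | {s : Finset ℕ | s.Nonempty ∧ ∀ t ∈ s, n ≤ t} ∈ U}
  obtain ⟨p, hp, hpp⟩ := exists_idempotent_in_compact_subsemigroup
    (Ultrafilter.continuous_mul_left (M := Finset ℕ)) S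
    (by
      refine ⟨(hyperfilter ℕ).map fun n => {n}, Set.mem_iInter.2 fun n => ?_⟩
      have : ∀ᶠ m in (hyperfilter ℕ : Filter ℕ), n ≤ m :=
        Nat.hyperfilter_le_atTop (eventually_ge_atTop n)
      change ∀ᶠ m in (hyperfilter ℕ : Filter ℕ),
        ({m} : Finset ℕ).Nonempty ∧ ∀ t ∈ ({m} : Finset ℕ), n ≤ t
      filter_upwards [this] with m hm
      simpa using hm)
    (isClosed_iInter fun n => ultrafilter_isClosed_basic _).isCompact
    (by
      intro U hU V hV
      simp only [S, Set.mem_iInter, Set.mem_ofPred_eq] at hU hV ⊢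
      intro n
      have : ∀ᶠ s in (U : Filter (Finset ℕ)), ∀ᶠ t in (V : Filter (Finset ℕ)),
          (s ∪ t).Nonempty ∧ ∀ x ∈ s ∪ t, n ≤ x := by
        filter_upwards [hU n] with s hs
        filter_upwards [hV n] with t ht
        refine ⟨hs.1.mono Finset.subset_union_left, fun x hx => ?_⟩
        exact (Finset.mem_union.1 hx).elim (hs.2 x) (ht.2 x)
      exact this)
  refine ⟨p, fun n => Set.mem_iInter.1 hp n, fun P hP => ?_⟩
  rw [← hpp] at hP
  exact hP

theorem exists_eventually_eq [Finite κ] {α : Type} (p : Ultrafilter α) (h : α → κ) :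
    ∃ i, ∀ᶠ s in p, h s = i := by
  obtain ⟨i, hi⟩ := (p.map h).eq_pure_of_finite
  refine ⟨i, ?_⟩
  have : ∀ᶠ x in (p.map h : Filter κ), x = i := by
    rw [hi]
    exact rfl
  exact this

/-- The limit of a coloring along an ultrafilter: the color that is taken almost everywhere. -/
noncomputable def limColor [Finite κ] {α : Type} (p : Ultrafilter α) (h : α → κ) : κ :=
  (exists_eventually_eq p h).choose

theorem eventually_eq_limColor [Finite κ] {α : Type} (p : Ultrafilter α) (h : α → κ) :
    ∀ᶠ s in p, h s = limColor p h := (exists_eventually_eq p h).choose_spec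

/-- Write the letter `e` at all the places in `s`. -/
def mark (φ : ℕ → Unit ⊕ E) (s : Finset ℕ) (e : E) : ℕ → Unit ⊕ E :=
  fun t => if t ∈ s then Sum.inr e else φ t

theorem mark_mark (φ : ℕ → Unit ⊕ E) (s t : Finset ℕ) (e : E) :
    mark (mark φ s e) t e = mark φ (s ∪ t) e := by
  funext x
  simp only [mark, Finset.mem_union]
  split_ifs <;> simp_all

/-- The iterated limit, along `p`, of the color of the word that is obtained from `φ` by marking
random sets `s₀ < s₁ < ⋯` by the labels in `es` one after the other and then truncating at the
least element of one more random set. -/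
noncomputable def iterLim [Finite κ] (p : Ultrafilter (Finset ℕ)) (f : List (Unit ⊕ E) → κ) :
    List E → (ℕ → Unit ⊕ E) → κ
  | [], φ => limColor p fun s => f ((List.range (sInf (s : Set ℕ))).map φ)
  | e :: es, φ => limColor p fun s => iterLim p f es (mark φ s e)

/-- The words that can follow when `cur` is the label used last (if any) and `es` are the labels
still to be used: each label of `es` is introduced in its turn, and only the label used last may be
repeated. -/
inductive Continues {K : Type} : Option E → List E → List (K ⊕ E) → Prop
  | nil (cur : Option E) : Continues cur [] []
  | letter (cur : Option E) (es : List E) (a : K) (y : List (K ⊕ E)) :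
      Continues cur es y → Continues cur es (Sum.inl a :: y)
  | repeated (e : E) (es : List E) (y : List (K ⊕ E)) :
      Continues (some e) es y → Continues (some e) es (Sum.inr e :: y)
  | fresh (cur : Option E) (e : E) (es : List E) (y : List (K ⊕ E)) :
      Continues (some e) es y → Continues cur (e :: es) (Sum.inr e :: y)

theorem Continues.substVia_append {K : Type} {e : E} {es : List E} {y : List (K ⊕ E)}
    (h : Continues (some e) es y) (w : List (Option K)) :
    Continues (some e) es (substVia Sum.inl w (Sum.inr e) ++ y) := by
  induction w with
  | nil => exact h
  | cons o w ih =>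
    cases o with
    | none => exact ih.repeated _ _ _
    | some a => exact ih.letter _ _ a _

theorem continues_eval {K : Type} (cur : Option E) {es : List E} {ws : List (List (Option K))}
    (hws : ∀ w ∈ ws, IsLeft w) (hl : ws.length = es.length) :
    Continues cur es (eval (Sum.inl : K → K ⊕ E) ws (es.map Sum.inr)) := by
  induction ws generalizing es cur with
  | nil =>
    rw [List.length_nil, eq_comm, List.length_eq_zero_iff] at hl
    subst hl
    exact .nil cur
  | cons w ws ih =>
    obtain _ | ⟨e, es⟩ := es
    · simp at hl
    have hw := hws w (by simp)
    obtain _ | ⟨o, w⟩ := w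
    · simp [IsLeft] at hw
    simp only [IsLeft, List.head?_cons, Option.some.injEq] at hw
    subst hw
    simp only [List.map_cons, eval_cons, substVia_cons, Option.elim_none, List.cons_append]
    exact ((ih (some e) (fun w h => hws w (List.mem_cons_of_mem _ h))
      (by simpa using hl)).substVia_append w).fresh _ _ _ _

theorem IsGeneric.continues {K : Type} {es : List E} {y : List (K ⊕ E)} (h : IsGeneric es y) :
    Continues none es y := by
  obtain ⟨c, ws, hws, hl, rfl⟩ := h
  rw [generic]
  induction c with
  | nil => exact continues_eval none hws hl
  | cons a c ih => exact ih.letter _ _ a _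

/-- A partially written word: the letters written so far, the label used last and the labels still
to be used. -/
structure Draft (E : Type) where
  /-- The letters written so far; all later places hold the only letter of the alphabet. -/
  word : ℕ → Unit ⊕ E
  /-- The label used last. -/
  cur : Option E
  /-- The labels still to be used. -/
  rest : List E

/-- Mark `s` by the label used last. -/
def Draft.repeated (s : Finset ℕ) (a : Draft E) : Draft E :=
  match a.cur with
  | none => a
  | some e => ⟨mark a.word s e, some e, a.rest⟩

/-- Mark `s` by the next label. -/
def Draft.fresh (s : Finset ℕ) (a : Draft E) : Draft E :=
  match a.rest with
  | [] => a
  | e :: es => ⟨mark a.word s e, some e, es⟩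

/-- The iterated limit for the draft `a` is the color `i`, and almost always it stays so when the
label used last is repeated. -/
def Draft.IsGood [Finite κ] (p : Ultrafilter (Finset ℕ)) (f : List (Unit ⊕ E) → κ) (i : κ)
    (a : Draft E) : Prop :=
  iterLim p f a.rest a.word = i ∧
    ∀ e, a.cur = some e → ∀ᶠ t in p, iterLim p f a.rest (mark a.word t e) = i

section Good

variable [Finite κ] {p : Ultrafilter (Finset ℕ)} {f : List (Unit ⊕ E) → κ} {i : κ}

/-- Idempotency of `p` lets the color survive a later repetition of the label just written. -/
theorem eventually_isGood_mark
    (hp : ∀ P : Finset ℕ → Prop, (∀ᶠ s in p, P s) → ∀ᶠ s in p, ∀ᶠ t in p, P (s ∪ t))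
    {φ : ℕ → Unit ⊕ E} {e : E} {es : List E} (h : ∀ᶠ s in p, iterLim p f es (mark φ s e) = i) :
    ∀ᶠ s in p, Draft.IsGood p f i ⟨mark φ s e, some e, es⟩ := by
  filter_upwards [h, hp _ h] with s hs hst
  refine ⟨hs, ?_⟩
  rintro e' ⟨⟩
  simpa only [mark_mark] using hst

theorem Draft.IsGood.eventually_repeated
    (hp : ∀ P : Finset ℕ → Prop, (∀ᶠ s in p, P s) → ∀ᶠ s in p, ∀ᶠ t in p, P (s ∪ t))
    {a : Draft E} (ha : a.IsGood p f i) : ∀ᶠ s in p, (a.repeated s).IsGood p f i := by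
  obtain ⟨φ, _ | e, es⟩ := a
  · exact .of_forall fun s => ha
  · exact eventually_isGood_mark hp (ha.2 e rfl)

theorem Draft.IsGood.eventually_fresh
    (hp : ∀ P : Finset ℕ → Prop, (∀ᶠ s in p, P s) → ∀ᶠ s in p, ∀ᶠ t in p, P (s ∪ t))
    {a : Draft E} (ha : a.IsGood p f i) : ∀ᶠ s in p, (a.fresh s).IsGood p f i := by
  obtain ⟨φ, cur, _ | ⟨e, es⟩⟩ := a
  · exact .of_forall fun s => ha
  · refine eventually_isGood_mark hp ?_
    have := eventually_eq_limColor p fun s => iterLim p f es (mark φ s e)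
    filter_upwards [this] with s hs
    exact hs.trans ha.1

theorem Draft.IsGood.eventually_truncate {a : Draft E} (ha : a.IsGood p f i) :
    ∀ᶠ s : Finset ℕ in p, a.rest = [] → f ((List.range (sInf (s : Set ℕ))).map a.word) = i := by
  obtain ⟨φ, cur, _ | ⟨e, es⟩⟩ := a
  · have := eventually_eq_limColor p fun s => f ((List.range (sInf (s : Set ℕ))).map φ)
    filter_upwards [this] with s hs _
    exact hs.trans ha.1
  · exact .of_forall fun s hs => by simp at hs

/-- Writing the letter `b` on `s`, and the letter of the alphabet elsewhere from `m` on, amounts to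
substituting `b` into the variable word on `[m, n)` whose variable sits on `s`. -/
theorem map_range_eq_append (φ ψ : ℕ → Unit ⊕ E) (b : Unit ⊕ E) (s : Finset ℕ) {m n : ℕ}
    (hmn : m ≤ n) (hlt : ∀ t < m, ψ t = φ t)
    (hge : ∀ t, m ≤ t → ψ t = if t ∈ s then b else Sum.inl ()) :
    (List.range n).map ψ = (List.range m).map φ ++
      substVia Sum.inl ((List.range' m (n - m)).map fun t => if t ∈ s then none else some ()) b := by
  have : List.range n = List.range m ++ List.range' m (n - m) := by
    have h := List.range'_append_1 (s := 0) (m := m) (n := n - m)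
    rw [Nat.zero_add, Nat.add_sub_of_le hmn] at h
    rw [List.range_eq_range', List.range_eq_range', h]
  rw [this, List.map_append]
  congr 1
  · exact List.map_congr_left fun t ht => hlt t (List.mem_range.1 ht)
  · rw [substVia, List.map_map]
    refine List.map_congr_left fun t ht => ?_
    rw [hge t (List.mem_range'_1.1 ht).1]
    simp only [Function.comp]
    split_ifs <;> rfl

/-- Finitely many good drafts can be completed simultaneously along a tree. The variable of each
variable word sits on a set that is typical for all the drafts that may arise before it, and the
next variable word starts at the least element of the next such set. -/
theorem exists_tree_of_forall_isGood
    (hp₀ : ∀ n : ℕ, ∀ᶠ s : Finset ℕ in p, s.Nonempty ∧ ∀ t ∈ s, n ≤ t)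
    (hp : ∀ P : Finset ℕ → Prop, (∀ᶠ s in p, P s) → ∀ᶠ s in p, ∀ᶠ t in p, P (s ∪ t))
    (d n : ℕ) (A : Set (Draft E)) (hA : A.Finite) (hgood : ∀ a ∈ A, a.IsGood p f i)
    (hn : ∀ a ∈ A, ∀ t, n ≤ t → a.word t = Sum.inl ()) :
    ∃ m, n ≤ m ∧ ∃ ws : List (List (Option Unit)), (∀ w ∈ ws, IsLeft w) ∧ ws.length = d ∧
      ∀ a ∈ A, ∀ y, Continues a.cur a.rest y → y.length ≤ d →
        f ((List.range m).map a.word ++ eval Sum.inl ws y) = i := by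
  induction d generalizing n A with
  | zero =>
    have h1 : ∀ᶠ s : Finset ℕ in p, ∀ a ∈ A, a.rest = [] →
        f ((List.range (sInf (s : Set ℕ))).map a.word) = i :=
      (eventually_all_finite hA).2 fun a ha => (hgood a ha).eventually_truncate
    obtain ⟨s, hs, hs₀, hsn⟩ := (h1.and (hp₀ n)).exists
    refine ⟨sInf (s : Set ℕ), hsn _ (Nat.sInf_mem (s := (s : Set ℕ)) hs₀), [], by simp, rfl,
      fun a ha y hy hyl => ?_⟩
    obtain rfl : y = [] := by simpa using hyl
    obtain ⟨φ, cur, _ | ⟨e, es⟩⟩ := a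
    · simpa using hs _ ha rfl
    · cases hy
  | succ d ih =>
    have h1 : ∀ᶠ s : Finset ℕ in p, ∀ a ∈ A, (a.rest = [] →
        f ((List.range (sInf (s : Set ℕ))).map a.word) = i) ∧
        (a.repeated s).IsGood p f i ∧ (a.fresh s).IsGood p f i :=
      (eventually_all_finite hA).2 fun a ha => (hgood a ha).eventually_truncate.and
        (((hgood a ha).eventually_repeated hp).and ((hgood a ha).eventually_fresh hp))
    obtain ⟨s, hs, hs₀, hsn⟩ := (h1.and (hp₀ n)).exists
    have hmin := Nat.sInf_mem (s := (s : Set ℕ)) hs₀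
    have hmin_le : ∀ t ∈ s, sInf (s : Set ℕ) ≤ t := fun t ht => Nat.sInf_le ht
    generalize sInf (s : Set ℕ) = k at *
    have hk : n ≤ k := hsn k hmin
    let n' := s.sup id + 1
    have hn' : ∀ t ∈ s, t < n' := fun t ht => Nat.lt_succ_of_le (Finset.le_sup (f := id) ht)
    have hkn : k < n' := hn' k hmin
    have hmark : ∀ a ∈ A, ∀ e t, n' ≤ t → mark a.word s e t = Sum.inl () := by
      intro a ha e t ht
      rw [mark, if_neg fun h => absurd (hn' t h) (by omega)]
      exact hn a ha t (by omega)
    obtain ⟨m, hm, ws, hws, hlen, hf⟩ := ih n'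
      (A ∪ (Draft.repeated s '' A ∪ Draft.fresh s '' A))
      (hA.union ((hA.image _).union (hA.image _)))
      (by
        rintro _ (ha | ⟨a, ha, rfl⟩ | ⟨a, ha, rfl⟩)
        · exact hgood _ ha
        · exact (hs a ha).2.1
        · exact (hs a ha).2.2)
      (by
        rintro _ (ha | ⟨a, ha, rfl⟩ | ⟨a, ha, rfl⟩) t ht
        · exact hn _ ha t (by omega)
        · rw [Draft.repeated]
          split
          · exact hn _ ha t (by omega)
          · exact hmark a ha _ t ht
        · rw [Draft.fresh]
          split
          · exact hn _ ha t (by omega)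
          · exact hmark a ha _ t ht)
    refine ⟨k, hk, (List.range' k (m - k)).map (fun t => if t ∈ s then none else some ()) :: ws,
      ?_, by simp [hlen], ?_⟩
    · simp only [List.mem_cons, forall_eq_or_imp]
      refine ⟨?_, hws⟩
      obtain ⟨r, hr⟩ : ∃ r, m - k = r + 1 := ⟨m - k - 1, by omega⟩
      have : k ∈ s := hmin
      simp [IsLeft, hr, List.range'_succ, this]
    intro a ha y hy hyl
    -- Writing the letter `b` on `s` extends the word up to `m`.
    have hext : ∀ (ψ : ℕ → Unit ⊕ E) (b : Unit ⊕ E) (y : List (Unit ⊕ E)),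
        (∀ t, ψ t = if t ∈ s then b else a.word t) →
        (List.range k).map a.word ++ eval Sum.inl
          ((List.range' k (m - k)).map (fun t => if t ∈ s then none else some ()) :: ws) (b :: y) =
        (List.range m).map ψ ++ eval Sum.inl ws y := by
      intro ψ b y hψ
      rw [map_range_eq_append a.word ψ b s (m := k) (by omega), eval_cons, List.append_assoc]
      · intro t ht
        rw [hψ, if_neg fun h => absurd (hmin_le t h) (by omega)]
      · intro t ht
        rw [hψ, hn a ha t (by omega)]
    obtain ⟨φ, cur, es⟩ := a
    cases hy with
    | nil => simpa using (hs _ ha).1 rfl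
    | letter _ _ u y hy =>
      rw [hext φ (Sum.inl u) y fun t => ?_]
      · exact hf _ (Or.inl ha) y hy (by simpa using hyl)
      · split_ifs with ht
        · exact hn _ ha t (hk.trans (hmin_le t ht))
        · rfl
    | repeated e _ y hy =>
      rw [hext (mark φ s e) (Sum.inr e) y fun t => rfl]
      exact hf _ (Or.inr (Or.inl ⟨_, ha, rfl⟩)) y hy (by simpa using hyl)
    | fresh _ e es y hy =>
      rw [hext (mark φ s e) (Sum.inr e) y fun t => rfl]
      exact hf _ (Or.inr (Or.inr ⟨_, ha, rfl⟩)) y hy (by simpa using hyl)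

end Good

/-- The theorem for words over an alphabet with one letter, without a bound for the size of the
tree. -/
theorem exists_tree_unit [Finite κ] (es : List E) (d : ℕ) (f : List (Unit ⊕ E) → κ) :
    ∃ (c : List Unit) (ws : List (List (Option Unit))), (∀ w ∈ ws, IsLeft w) ∧ ws.length = d ∧
      ∃ i, ∀ y, IsGeneric es y → y.length ≤ d → f (c.map Sum.inl ++ eval Sum.inl ws y) = i := by
  obtain ⟨p, hp₀, hp⟩ := exists_idempotent_union
  let a : Draft E := ⟨fun _ => Sum.inl (), none, es⟩
  obtain ⟨m, -, ws, hws, hlen, hf⟩ := exists_tree_of_forall_isGood (f := f)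
    (i := iterLim p f es fun _ => Sum.inl ()) hp₀ hp d 0 {a} (Set.finite_singleton a)
    (by
      rintro _ rfl
      exact ⟨rfl, by simp [a]⟩)
    (by
      rintro _ rfl t -
      rfl)
  refine ⟨(List.range m).map fun _ => (), ws, hws, hlen, iterLim p f es fun _ => Sum.inl (),
    fun y hy hyl => ?_⟩
  have := hf a rfl y hy.continues hyl
  rwa [List.map_map]

end Unary

end CarlsonSimpson

/-! ### Bounds by compactness, and general alphabets -/

namespace CarlsonSimpson

open Filter

section Bounds

variable {K E κ : Type}

/-- The tree generated by `(c, ws)` has dimension `d`, and the coloring `f` is constant on the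
generic words of its subtrees of dimension `es.length`. -/
def IsMonoTree (es : List E) (d : ℕ) (f : List (K ⊕ E) → κ) (c : List K)
    (ws : List (List (Option K))) : Prop :=
  (∀ w ∈ ws, IsLeft w) ∧ ws.length = d ∧
    ∃ i, ∀ y, IsGeneric es y → y.length ≤ d → f (c.map Sum.inl ++ eval Sum.inl ws y) = i

/-- Compactness: if every coloring has a monochromatic tree, then these trees can be found within a
bounded height. Otherwise the limit, along a free ultrafilter, of colorings without monochromatic
trees of height at most `0, 1, 2, …` would have a monochromatic tree, and this tree involves
finitely many words only. -/
theorem exists_bound_isMonoTree [Finite K] [Finite E] [Finite κ] (es : List E) (d : ℕ)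
    (h : ∀ f : List (K ⊕ E) → κ, ∃ c ws, IsMonoTree es d f c ws) :
    ∃ N : ℕ, ∀ f : List (K ⊕ E) → κ, ∃ c ws, IsMonoTree es d f c ws ∧ c.length + total ws ≤ N := by
  by_contra! H
  choose f hf using H
  obtain ⟨c, ws, hws, hlen, i, hi⟩ := h fun x => limColor (hyperfilter ℕ) fun N => f N x
  have h1 : ∀ᶠ N in (hyperfilter ℕ : Filter ℕ), ∀ y ∈ {y : List (K ⊕ E) | y.length ≤ d},
      f N (c.map Sum.inl ++ eval Sum.inl ws y) =
        limColor (hyperfilter ℕ) fun N => f N (c.map Sum.inl ++ eval Sum.inl ws y) :=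
    (eventually_all_finite (List.finite_length_le _ d)).2 fun y _ => eventually_eq_limColor _ _
  have h2 : ∀ᶠ N in (hyperfilter ℕ : Filter ℕ), c.length + total ws ≤ N :=
    Nat.hyperfilter_le_atTop (eventually_ge_atTop _)
  obtain ⟨N, hN1, hN2⟩ := (h1.and h2).exists
  exact absurd hN2 (not_le.2 (hf N c ws
    ⟨hws, hlen, i, fun y hy hyl => (hN1 y hyl).trans (hi y hy hyl)⟩))

/-- A change of alphabet turns generic words into generic words. -/
theorem IsGeneric.map {K' : Type} {es : List E} {y : List (K ⊕ E)} (h : IsGeneric es y)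
    (g : K → K') : IsGeneric es (y.map (Sum.map g id)) := by
  obtain ⟨c, ws, hws, hl, rfl⟩ := h
  refine ⟨c.map g, ws.map (List.map (Option.map g)), ?_, by simpa using hl, map_generic ..⟩
  intro w hw
  obtain ⟨v, hv, rfl⟩ := List.mem_map.1 hw
  exact (hws v hv).map g

/-- Every coloring of words has a monochromatic tree: a coloring that is blind to the letters of
`K` is a coloring of words over a one-letter alphabet. -/
theorem exists_isMonoTree [Finite K] [Nonempty K] [Finite E] [Finite κ] (es : List E) (d : ℕ)
    (f : List (K ⊕ E) → κ) : ∃ c ws, IsMonoTree es d f c ws := by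
  obtain ⟨N, hN⟩ := exists_bound_isMonoTree (K := Unit) (κ := κ) es d
    fun f => exists_tree_unit es d f
  obtain ⟨c₀, ts, hts, htl, hf⟩ := exists_tree_forall_eq N κ f
  obtain ⟨a₀⟩ := ‹Nonempty K›
  let g : Unit → K := fun _ => a₀
  obtain ⟨c, ws, ⟨hws, hlen, i, hi⟩, hle⟩ := hN fun y =>
    f (c₀.map Sum.inl ++ eval Sum.inl ts (y.map (Sum.map g id)))
  let ws' := ws.map (List.map (Option.map g))
  have htot : total ws' = total ws := by
    simp only [total, ws', List.map_map]
    congr 1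
    exact List.map_congr_left fun w _ => by simp
  have hws' : ∀ w ∈ ws', IsLeft w := by
    intro w hw
    obtain ⟨v, hv, rfl⟩ := List.mem_map.1 hw
    exact (hws v hv).map g
  refine ⟨c₀ ++ eval id ts (c.map g), compose (ts.drop (c.map g).length) ws', ?_,
    by simp [ws', hlen], i, fun y hy hyl => ?_⟩
  · exact isLeft_compose (fun t ht => hts t (List.mem_of_mem_drop ht)) hws'
      (by simp only [htot, List.length_drop, List.length_map, htl]; omega)
  let u : List (Unit ⊕ E) := y.map (Sum.map (fun _ => ()) id)
  have heq := hi u (hy.map _) (by simpa [u] using hyl)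
  have hcomp : (c₀ ++ eval id ts (c.map g)).map Sum.inl ++
      eval Sum.inl (compose (ts.drop (c.map g).length) ws') y = c₀.map Sum.inl ++
        eval (Sum.inl : K → K ⊕ E) ts ((c.map g).map Sum.inl ++ eval Sum.inl ws' y) := by
    simp [eval_append, eval_compose, map_eval]
  rw [hcomp, ← heq]
  refine hf _ _ ?_ ?_
  · have := length_eval_le (Sum.inl : K → K ⊕ E) ws' y
    simp only [List.length_append, List.length_map]
    omega
  · simp only [ws', u, List.map_append, List.map_map, map_eval, eval_map]
    congr 2
    refine List.map_congr_left fun b _ => ?_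
    cases b <;> rfl

end Bounds

/-! ### Trees as sets of words -/

section Trees

variable {k : ℕ}

theorem point_eq (c : Word k) (ws : List (VarSeq k)) (a : Word k) :
    point c ws a = c ++ eval id ws a := by
  have : (subst : VarSeq k → Fin k → Word k) = substVia id := by
    funext w a
    refine List.map_congr_left fun o _ => ?_
    cases o <;> rfl
  rw [point, eval, this]

/-- The points of a composite tree are the images of the points of the inner tree. -/
theorem point_compose (c₀ c : Word k) (ts ws : List (VarSeq k)) (a : Word k) :
    point (c₀ ++ eval id ts c) (compose (ts.drop c.length) ws) a =
      point c₀ ts (point c ws a) := by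
  simp [point_eq, eval_append, eval_compose]

theorem generated_compose (c₀ c : Word k) (ts ws : List (VarSeq k)) :
    generated (c₀ ++ eval id ts c) (compose (ts.drop c.length) ws) =
      point c₀ ts '' generated c ws := by
  ext x
  constructor
  · rintro ⟨a, ha, rfl⟩
    exact ⟨_, ⟨a, by simpa using ha, rfl⟩, (point_compose ..).symm⟩
  · rintro ⟨_, ⟨a, ha, rfl⟩, rfl⟩
    exact ⟨a, by simpa using ha, (point_compose ..).symm⟩

theorem image_generated_subset (c₀ c : Word k) (ts ws : List (VarSeq k))
    (h : c.length + total ws ≤ ts.length) :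
    point c₀ ts '' generated c ws ⊆ generated c₀ ts := by
  rintro _ ⟨_, ⟨a, -, rfl⟩, rfl⟩
  refine ⟨_, ?_, rfl⟩
  have := length_eval_le id ws a
  rw [point_eq, List.length_append]
  omega

/-- The subtrees of a tree are its composites with other trees. -/
theorem exists_image_eq [Nontrivial (Fin k)] {m : ℕ} {c₀ : Word k} {ts : List (VarSeq k)}
    (hts : ∀ t ∈ ts, IsLeft t) {V : Set (Word k)} (hV : IsTree m V)
    (hsub : V ⊆ generated c₀ ts) :
    ∃ (c : Word k) (ws : List (VarSeq k)), (∀ w ∈ ws, IsLeft w) ∧ ws.length = m ∧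
      c.length + total ws ≤ ts.length ∧ V = point c₀ ts '' generated c ws := by
  obtain ⟨x, us, -, hlen, hus, rfl⟩ := hV
  have hsub' : ∀ b : Word k, b.length ≤ us.length → ∃ z : Word k, z.length ≤ ts.length ∧
      x ++ eval id us b = c₀ ++ eval id ts z := fun b hb => by
    obtain ⟨z, hz, hxz⟩ := hsub ⟨b, hb, rfl⟩
    exact ⟨z, hz, by rwa [point_eq, point_eq] at hxz⟩
  obtain ⟨c, hc, hx⟩ := hsub' [] (Nat.zero_le _)
  rw [eval_nil_right, List.append_nil] at hx
  obtain ⟨ws, hws, hl, htot, hcomp⟩ := exists_eq_compose hts hus hc fun b hb => by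
    obtain ⟨z, hz, hxz⟩ := hsub' b hb
    rw [hx, List.append_assoc] at hxz
    exact ⟨z, hz, List.append_cancel_left hxz⟩
  exact ⟨c, ws, hws, hl.trans hlen, htot, by rw [hx, hcomp, generated_compose]⟩

theorem isTree_image {d : ℕ} (hd : 1 ≤ d) {c₀ c : Word k} {ts ws : List (VarSeq k)}
    (hts : ∀ t ∈ ts, IsLeft t) (hws : ∀ w ∈ ws, IsLeft w) (hl : ws.length = d)
    (h : c.length + total ws ≤ ts.length) : IsTree d (point c₀ ts '' generated c ws) := by
  refine ⟨_, _, ?_, ?_, ?_, (generated_compose c₀ c ts ws).symm⟩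
  · rw [← List.length_pos_iff_ne_nil, length_compose]
    omega
  · rw [length_compose, hl]
  · exact isLeft_compose (fun t ht => hts t (List.mem_of_mem_drop ht)) hws
      (by rw [List.length_drop]; omega)

end Trees

/-- The partition property holds for the height bound of monochromatic trees, for the coloring of
words that gives the generic word of a tree the color of its image in `W`. -/
theorem exists_partitionProperty {k d m r : ℕ} (hk : 2 ≤ k) (hm : 1 ≤ m) (hd : m ≤ d)
    (hr : 1 ≤ r) : ∃ N, PartitionProperty k d m r N := by
  have : Nontrivial (Fin k) := Fin.nontrivial_iff_two_le.2 hk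
  let es : List (Fin m) := List.finRange m
  have hes : es.Nodup := List.nodup_finRange m
  have hesl : es.length = m := List.length_finRange
  obtain ⟨N, hN⟩ := exists_bound_isMonoTree (K := Fin k) (κ := Fin r) es d
    fun f => exists_isMonoTree es d f
  refine ⟨N, ?_⟩
  rintro n hn W ⟨c₀, ts, -, htl, hts, rfl⟩ color
  have hsubtr : ∀ (c : Word k) (ws : List (VarSeq k)), (∀ w ∈ ws, IsLeft w) → ws.length = m →
      c.length + total ws ≤ ts.length →
      point c₀ ts '' generated c ws ∈ Subtr m (generated c₀ ts) := fun c ws hws hl h =>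
    ⟨isTree_image hm hts hws hl h, image_generated_subset c₀ c ts ws h⟩
  obtain ⟨F, hF⟩ : ∃ F : List (Fin k ⊕ Fin m) → Fin r, ∀ (c : Word k) (ws : List (VarSeq k))
      (hws : ∀ w ∈ ws, IsLeft w) (hl : ws.length = m) (h : c.length + total ws ≤ ts.length),
      F (generic es c ws) = color ⟨_, hsubtr c ws hws hl h⟩ := by
    classical
    refine ⟨fun y => if h : ∃ V : Subtr m (generated c₀ ts), ∃ (c : Word k)
      (ws : List (VarSeq k)), (∀ w ∈ ws, IsLeft w) ∧ ws.length = m ∧ y = generic es c ws ∧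
        (V : Set (Word k)) = point c₀ ts '' generated c ws then color h.choose else ⟨0, hr⟩,
      fun c ws hws hl h => ?_⟩
    have hex : ∃ V : Subtr m (generated c₀ ts), ∃ (c' : Word k) (ws' : List (VarSeq k)),
        (∀ w ∈ ws', IsLeft w) ∧ ws'.length = m ∧ generic es c ws = generic es c' ws' ∧
          (V : Set (Word k)) = point c₀ ts '' generated c' ws' :=
      ⟨⟨_, hsubtr c ws hws hl h⟩, c, ws, hws, hl, rfl, rfl⟩
    refine (dif_pos hex).trans ?_
    congr 1
    obtain ⟨c', ws', hws', hl', heq, hV⟩ := hex.choose_spec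
    obtain ⟨rfl, rfl⟩ := generic_inj hes hws hws' (hl.trans hesl.symm) (hl'.trans hesl.symm) heq
    exact Subtype.ext hV
  obtain ⟨c, ws, ⟨hws, hwl, i, hi⟩, hle⟩ := hN F
  have hle' : c.length + total ws ≤ ts.length := by omega
  refine ⟨point c₀ ts '' generated c ws, ⟨isTree_image (hm.trans hd) hts hws hwl hle',
    image_generated_subset c₀ c ts ws hle'⟩, i, ?_⟩
  rintro ⟨V, hVW⟩ ⟨hV, hVU⟩
  -- `V` is a composite with the tree generated by `(c, ws)`, composed with `W`.
  rw [← generated_compose] at hVU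
  have hleft := isLeft_compose (fun t ht => hts t (List.mem_of_mem_drop ht)) hws
    (show total ws ≤ (ts.drop c.length).length by rw [List.length_drop]; omega)
  obtain ⟨c', ws', hws', hl', htot', hVeq⟩ := exists_image_eq hleft hV hVU
  rw [length_compose] at htot'
  have hleft' := isLeft_compose (fun t ht => hws t (List.mem_of_mem_drop ht)) hws'
    (show total ws' ≤ (ws.drop c'.length).length by rw [List.length_drop]; omega)
  have hgen : generic es (c ++ eval id ws c') (compose (ws.drop c'.length) ws') =
      c.map Sum.inl ++ eval Sum.inl ws (generic es c' ws') := generic_compose es c c' ws ws'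
  have hlen := length_eval_le (Sum.inl : Fin k → Fin k ⊕ Fin m) ws (generic es c' ws')
  have hfit : (c ++ eval id ws c').length + total (compose (ws.drop c'.length) ws') ≤
      ts.length := by
    rw [← length_generic (es := es) (by rw [length_compose, hl', hesl]), hgen,
      List.length_append, List.length_map]
    omega
  have hcol := hi (generic es c' ws') ⟨c', ws', hws', by rw [hl', hesl], rfl⟩
    (by rw [length_generic (by rw [hl', hesl])]; omega)
  rw [← hgen, hF _ _ hleft' (by rw [length_compose, hl']) hfit] at hcol
  rw [← hcol]
  congr 1
  refine Subtype.ext (hVeq.trans ?_)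
  change _ = point c₀ ts '' generated _ _
  rw [generated_compose, Set.image_image]
  exact Set.image_congr fun x _ => point_compose c₀ c ts ws x

end CarlsonSimpson

theorem theorem4p1 (k d m r : ℕ) (hk : 2 ≤ k) (hm : 1 ≤ m) (hd : m ≤ d) (hr : 1 ≤ r) :
    ∃ N : ℕ, IsLeast {N' : ℕ | CarlsonSimpson.PartitionProperty k d m r N'} N := by
  classical
  have h := CarlsonSimpson.exists_partitionProperty hk hm hd hr
  exact ⟨Nat.find h, Nat.find_spec h, fun N hN => Nat.find_min' h hN⟩
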